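/- A graph $X=(X_0,X_1,s,t)$ consists of a set $X_0$ of nodes, a set $X_1$ of arcs, and functions $s,t:X_1\to X_0$ (source and target). A graph morphism $f:X\to Y$ is a pair of functions $f_0:X_0\to Y_0$, $f_1:X_1\to Y_1$ with $s f_1=f_0 s$ and $t f_1=f_0 t$. Let $\mathrm{Gph}$ be the category of graphs and graph morphisms, and write $X(x,*)$ for the set of arcs of $X$ with source $x$. A graph morphism $f:X\to Y$ is a *Covering* if for every node $x$ of $X$ it induces a bijection $X(x,*)\to Y(f(x),*)$. A root of a graph is a node that is not the target of any arc. A rooted tree is a graph $T$ with exactly one root $r$ such that for each node $x$ of $T$ there is a unique directed path (of finite length $\ge 0$) in $T$ from $r$ to $x$. A rooted forest is a coproduct of a (possibly empty) family of rooted trees; for a rooted forest $F$, let $R(F)$ be the discrete subgraph of its roots. A graph morphism $f:X\to Y$ is a *Whiskering* if there are a rooted forest $F$ and a morphism $\varphi:R(F)\to X$ such that $f$ is the pushout of the inclusion $R(F)\to F$ along $\varphi$. Let $\mathbf{A}$ be the graph with two nodes and one arc from the first to the second, let $\mathbf{V}$ be the graph with three nodes $0,1',1''$ and two arcs $a':0\to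 1'$ and $a'':0\to 1''$, and let $\mathbf{f}:\mathbf{V}\to\mathbf{A}$ be the morphism sending both arcs to the arc of $\mathbf{A}$. An elementary folding is a pushout $X\to\underline{X}$ of $\mathbf{f}$ along some morphism $h:\mathbf{V}\to X$. A *Folding* is a (possibly transfinite, possibly empty) composition of elementary foldings, so isomorphisms are Foldings. Let $\mathrm{Whisker}/\mathrm{Fold}$ be the class of graph morphisms that can be factored as a Whiskering followed by a Folding. For morphisms $\ell:X\to Y$ and $r:A\to B$ of a category, write $\ell\perp r$ if for all $f:X\to A$ and $g:Y\to B$ with $rf=g\ell$ there is a unique $h:Y\to A$ with $h\ell=f$ and $rh=g$. For a class $\mathcal{F}$ of morphisms put $\mathcal{F}^\perp=\{r:\ell\perp r\ \text{for all}\ \ell\in\mathcal{F}\}$ and ${}^\perp\mathcal{F}=\{\ell:\ell\perp r\ \text{for all}\ r\in\mathcal{F}\}$. A Freyd–Kelly factorization system in a category is a pair of classes $((\mathcal{L},\mathcal{R}))$ of morphisms with $\mathcal{L}^\perp=\mathcal{R}$ and $\mathcal{L}={}^\perp\mathcal{R}$, such that every morphism $c$ can be written as $c=r\circ\ell$ with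 $\ell\in\mathcal{L}$ and $r\in\mathcal{R}$. **Proposition.** $((\mathrm{Whisker}/\mathrm{Fold},\ \mathrm{Covering}))$ is a Freyd–Kelly factorization system in $\mathrm{Gph}$. -/

import Mathlib

open CategoryTheory CategoryTheory.Limits

universe u v w

/-! ### Orthogonality and Freyd–Kelly factorization systems -/

section Orthogonality

variable {C : Type u} [Category.{v} C]

/-- `l ⊥ r`: every commutative square `f ≫ r = l ≫ g` has a unique diagonal filler. -/
def Orthogonal {X Y A B : C} (l : X ⟶ Y) (r : A ⟶ B) : Prop :=
  ∀ (f : X ⟶ A) (g : Y ⟶ B), f ≫ r = l ≫ g → ∃! h : Y ⟶ A, l ≫ h = f ∧ h ≫ r = g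

/-- The class of all `r` such that `l ⊥ r` for every `l` in `L`. -/
def rightOrthogonal (L : MorphismProperty C) : MorphismProperty C :=
  fun _ _ r => ∀ ⦃X Y : C⦄ (l : X ⟶ Y), L l → Orthogonal l r

/-- The class of all `l` such that `l ⊥ r` for every `r` in `R`. -/
def leftOrthogonal (R : MorphismProperty C) : MorphismProperty C :=
  fun _ _ l => ∀ ⦃A B : C⦄ (r : A ⟶ B), R r → Orthogonal l r

/-- The pair `(L, R)` is a Freyd–Kelly factorization system. -/
structure IsFreydKellyFactorizationSystem (L R : MorphismProperty C) : Prop where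
  rightOrthogonal_eq : rightOrthogonal L = R
  leftOrthogonal_eq : leftOrthogonal R = L
  exists_factorization : ∀ ⦃X Y : C⦄ (c : X ⟶ Y),
    ∃ (Z : C) (l : X ⟶ Z) (r : Z ⟶ Y), L l ∧ R r ∧ l ≫ r = c

end Orthogonality

/-! ### The category of (directed) graphs -/

/-- A directed graph: a set of nodes, a set of arcs, source and target functions. -/
structure Gph where
  /-- The set of nodes. -/
  Node : Type u
  /-- The set of arcs. -/
  Arc : Type u
  /-- The source of an arc. -/
  src : Arc → Node
  /-- The target of an arc. -/
  tgt : Arc → Node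

namespace Gph

/-- A graph morphism: functions on nodes and on arcs compatible with sources and targets. -/
@[ext]
structure Hom (X Y : Gph.{u}) where
  /-- The function on nodes. -/
  onNode : X.Node → Y.Node
  /-- The function on arcs. -/
  onArc : X.Arc → Y.Arc
  src_onArc : ∀ a, Y.src (onArc a) = onNode (X.src a)
  tgt_onArc : ∀ a, Y.tgt (onArc a) = onNode (X.tgt a)

instance : Category Gph.{u} where
  Hom X Y := Hom X Y
  id X := ⟨fun x => x, fun a => a, fun _ => rfl, fun _ => rfl⟩
  comp f g := ⟨fun x => g.onNode (f.onNode x), fun a => g.onArc (f.onArc a),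
    fun a => by rw [g.src_onArc, f.src_onArc], fun a => by rw [g.tgt_onArc, f.tgt_onArc]⟩

/-- The set of arcs of `X` with source `x`. -/
def outArcs (X : Gph.{u}) (x : X.Node) : Set X.Arc := {a | X.src a = x}

/-- Coverings: the morphisms that are bijective on out-arcs at each node. -/
def covering : MorphismProperty Gph.{u} :=
  fun X Y f => ∀ x : X.Node, Set.BijOn f.onArc (X.outArcs x) (Y.outArcs (f.onNode x))

/-! ### Rooted trees, rooted forests and Whiskerings -/

/-- The path graph with nodes `0, …, n` and one arc from `i` to `i + 1` for each `i < n`. -/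
def pathGraph (n : ℕ) : Gph.{u} where
  Node := ULift (Fin (n + 1))
  Arc := ULift (Fin n)
  src i := ⟨i.down.castSucc⟩
  tgt i := ⟨i.down.succ⟩

/-- A (directed) path in `X`: a morphism from a path graph to `X`. -/
structure GPath (X : Gph.{u}) where
  /-- The length of the path. -/
  length : ℕ
  /-- The underlying morphism. -/
  hom : pathGraph.{u} length ⟶ X

/-- The initial node of a path. -/
def GPath.first {X : Gph.{u}} (p : X.GPath) : X.Node := p.hom.onNode ⟨0⟩

/-- The final node of a path. -/
def GPath.last {X : Gph.{u}} (p : X.GPath) : X.Node := p.hom.onNode ⟨Fin.last p.length⟩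

/-- A root is a node that is not the target of any arc. -/
def IsRoot (X : Gph.{u}) (x : X.Node) : Prop := ∀ a : X.Arc, X.tgt a ≠ x

/-- A rooted tree: there is exactly one root `r`, and each node `x` is the end of a unique path
from `r` to `x`. -/
def IsRootedTree (T : Gph.{u}) : Prop :=
  ∃ r : T.Node, (∀ x, T.IsRoot x ↔ x = r) ∧
    ∀ x : T.Node, ∃! p : T.GPath, p.first = r ∧ p.last = x

/-- A rooted forest: a coproduct of a (possibly empty) family of rooted trees. -/
def IsRootedForest (F : Gph.{u}) : Prop :=
  ∃ (ι : Type u) (T : ι → Gph.{u}) (j : ∀ i, T i ⟶ F),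
    (∀ i, (T i).IsRootedTree) ∧ Nonempty (IsColimit (Cofan.mk F j))

/-- The set of roots of `X`, as a discrete graph. -/
def roots (X : Gph.{u}) : Gph.{u} where
  Node := {x : X.Node // X.IsRoot x}
  Arc := PEmpty
  src a := a.elim
  tgt a := a.elim

/-- The inclusion of the discrete graph of roots. -/
def rootsInclusion (X : Gph.{u}) : X.roots ⟶ X :=
  Hom.mk (fun x => x.1) (fun a => a.elim) (fun a => a.elim) (fun a => a.elim)

/-- Whiskerings: `f : X ⟶ Y` exhibits `Y` as formed by attaching a rooted forest `F` to `X` along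
the roots of `F`. -/
def whiskering : MorphismProperty Gph.{u} :=
  fun X Y f => ∃ (F : Gph.{u}) (φ : F.roots ⟶ X) (k : F ⟶ Y),
    F.IsRootedForest ∧ IsPushout φ F.rootsInclusion f k

/-! ### Foldings -/

/-- The two nodes of the arc graph. -/
inductive ArcGraphNode : Type u
  | source
  | target

/-- The graph with one arc and two nodes, its source and its target. -/
def arcGraph : Gph.{u} where
  Node := ArcGraphNode
  Arc := PUnit
  src _ := .source
  tgt _ := .target

/-- The three nodes of the graph `V`. -/
inductive VGraphNode : Type u
  | center
  | left
  | right

/-- The two arcs of the graph `V`. -/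
inductive VGraphArc : Type u
  | left
  | right

/-- The graph `V` with two arcs, from a common source to two distinct targets. -/
def vGraph : Gph.{u} where
  Node := VGraphNode
  Arc := VGraphArc
  src _ := .center
  tgt
    | .left => .left
    | .right => .right

/-- The morphism from `V` to the arc graph that takes both arcs to the only arc. -/
def vFold : vGraph.{u} ⟶ arcGraph.{u} :=
  Hom.mk
    (fun
      | .center => .source
      | .left => .target
      | .right => .target)
    (fun _ => PUnit.unit)
    (fun _ => rfl)
    (fun
      | .left => rfl
      | .right => rfl)

/-- Elementary foldings: pushouts of `vFold` along morphisms `V ⟶ X`. -/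
def elementaryFolding : MorphismProperty Gph.{u} :=
  fun X Y f => ∃ (h : vGraph.{u} ⟶ X) (k : arcGraph.{u} ⟶ Y), IsPushout h vFold.{u} f k

/-- Foldings: (possibly transfinite) compositions of elementary foldings. -/
def folding : MorphismProperty Gph.{u} :=
  MorphismProperty.transfiniteCompositions.{u} elementaryFolding.{u}

/-- The morphisms that factor as a Whiskering followed by a Folding. -/
def whiskerFold : MorphismProperty Gph.{u} :=
  fun X Y f => ∃ (Z : Gph.{u}) (p : X ⟶ Z) (q : Z ⟶ Y), whiskering p ∧ folding q ∧ p ≫ q = f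

end Gph

/-! The two classes are orthogonal to each other and factor every morphism; the retract argument
`IsFreydKellyFactorizationSystem.of_orthogonal` then yields both orthogonality equations.

A covering lifts an arc uniquely once its source is lifted. Hence a morphism on a forest lifts
uniquely from the roots outward (`IsForestlike.orthogonal`), and arcs with a common source that
become equal in the base are already equal upstairs, which handles foldings (`folding.orthogonal`).

To factor `c : X ⟶ Y`, attach to each node `x` of `X` the tree of all walks in `Y` from the image of
`x`. The result maps to `Y` surjectively on out-arcs, because walks can be extended. Identifying
arcs with equal source and equal image until no such pair remains
(`Cong.exists_folding_outInjective`) adds injectivity and keeps surjectivity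
(`exists_whiskerFold_covering`). Folded graphs are treated as quotients by congruences, so a
transfinite folding is an increasing chain in the complete lattice of congruences. -/

section Orthogonality

variable {C : Type u} [Category.{v} C]

/-! ### Closure properties of orthogonality and the retract argument -/

theorem Orthogonal.of_isPushout {X Y Z W A B : C} {l : X ⟶ Y} {l' : Z ⟶ W} {φ : X ⟶ Z}
    {k : Y ⟶ W} (h : IsPushout φ l l' k) {r : A ⟶ B} (o : Orthogonal l r) : Orthogonal l' r := by
  intro f g e
  obtain ⟨d, ⟨hd₁, hd₂⟩, hd⟩ := o (φ ≫ f) (k ≫ g) (by rw [Category.assoc, e, h.w_assoc])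
  refine ⟨h.desc f d hd₁.symm, ⟨h.inl_desc _ _ _, h.hom_ext ?_ ?_⟩, ?_⟩
  · rw [h.inl_desc_assoc, e]
  · rw [h.inr_desc_assoc, hd₂]
  · rintro d' ⟨h₁, h₂⟩
    refine h.hom_ext ?_ ?_
    · rw [h.inl_desc, h₁]
    · rw [h.inr_desc]
      refine hd _ ⟨?_, ?_⟩
      · rw [← h.w_assoc, h₁]
      · rw [Category.assoc, h₂]

theorem Orthogonal.comp {X Y Z A B : C} {l : X ⟶ Y} {l' : Y ⟶ Z} {r : A ⟶ B}
    (o : Orthogonal l r) (o' : Orthogonal l' r) : Orthogonal (l ≫ l') r := by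
  intro f g e
  obtain ⟨d, ⟨hd₁, hd₂⟩, hd⟩ := o f (l' ≫ g) (by rw [e, Category.assoc])
  obtain ⟨d', ⟨hd'₁, hd'₂⟩, hd'⟩ := o' d g hd₂
  refine ⟨d', ⟨by rw [Category.assoc, hd'₁, hd₁], hd'₂⟩, ?_⟩
  rintro k ⟨hk₁, hk₂⟩
  refine hd' k ⟨hd _ ⟨?_, ?_⟩, hk₂⟩
  · rw [← hk₁, Category.assoc]
  · rw [Category.assoc, hk₂]

/-- Splits unique lifting into two properties, lifting and being epi, each of which passes
separately to pushouts and transfinite compositions. -/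
theorem Orthogonal.of_hasLiftingProperty_of_epi {X Y A B : C} (l : X ⟶ Y) (r : A ⟶ B)
    [HasLiftingProperty l r] [Epi l] : Orthogonal l r := by
  intro f g e
  have sq : CommSq f l r g := ⟨e⟩
  refine ⟨sq.lift, ⟨sq.fac_left, sq.fac_right⟩, ?_⟩
  rintro d ⟨hd, -⟩
  rw [← cancel_epi l, hd, sq.fac_left]

/-- A morphism out of a colimit is determined on the legs, and each component `f.app j` can be
cancelled there. -/
instance epimorphisms_isStableUnderColimitsOfShape (J : Type w) [Category J] :
    (MorphismProperty.epimorphisms C).IsStableUnderColimitsOfShape J where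
  condition X₁ X₂ c₁ c₂ h₁ h₂ f hf φ hφ := by
    refine ⟨fun g g' e => h₂.hom_ext fun j => ?_⟩
    have : Epi (f.app j) := hf j
    rw [← cancel_epi (f.app j), ← Category.assoc, ← Category.assoc, ← hφ, Category.assoc, e,
      Category.assoc]

instance epimorphisms_isStableUnderTransfiniteComposition :
    MorphismProperty.IsStableUnderTransfiniteComposition.{w} (MorphismProperty.epimorphisms C) where
  isStableUnderTransfiniteCompositionOfShape _ _ _ _ _ :=
    .of_isStableUnderColimitsOfShape fun _ _ _ _ _ => inferInstance

/-- The retract argument: two classes orthogonal to each other, closed under isomorphisms and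
factoring every morphism, form a Freyd–Kelly factorization system. -/
theorem IsFreydKellyFactorizationSystem.of_orthogonal {L R : MorphismProperty C}
    [L.RespectsIso] [R.RespectsIso]
    (o : ∀ ⦃X Y A B : C⦄ (l : X ⟶ Y) (r : A ⟶ B), L l → R r → Orthogonal l r)
    (fac : ∀ ⦃X Y : C⦄ (c : X ⟶ Y),
      ∃ (Z : C) (l : X ⟶ Z) (r : Z ⟶ Y), L l ∧ R r ∧ l ≫ r = c) :
    IsFreydKellyFactorizationSystem L R where
  rightOrthogonal_eq := by
    ext A B r
    refine ⟨fun h => ?_, fun h _ _ l hl => o l r hl h⟩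
    obtain ⟨Z, l, r', hl, hr', rfl⟩ := fac r
    obtain ⟨d, ⟨hd₁, hd₂⟩, -⟩ := h l hl (𝟙 A) r' (Category.id_comp _)
    -- Both `d ≫ l` and `𝟙 Z` fill the square from `l` to `r'` with sides `l` and `r'`.
    have hd₃ : d ≫ l = 𝟙 Z := (o l r' hl hr' l r' rfl).unique
      ⟨by rw [← Category.assoc, hd₁, Category.id_comp], by rw [Category.assoc, hd₂]⟩
      ⟨Category.comp_id _, Category.id_comp _⟩
    have : IsIso l := ⟨d, hd₁, hd₃⟩
    exact (R.cancel_left_of_respectsIso l r').2 hr'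
  leftOrthogonal_eq := by
    ext X Y l
    refine ⟨fun h => ?_, fun h _ _ r hr => o l r h hr⟩
    obtain ⟨Z, l', r, hl', hr, rfl⟩ := fac l
    obtain ⟨d, ⟨hd₁, hd₂⟩, -⟩ := h r hr l' (𝟙 Y) (Category.comp_id _).symm
    have hd₃ : r ≫ d = 𝟙 Z := (o l' r hl' hr l' r rfl).unique
      ⟨by rw [← Category.assoc, hd₁], by rw [Category.assoc, hd₂, Category.comp_id]⟩
      ⟨Category.comp_id _, Category.id_comp _⟩
    have : IsIso r := ⟨d, hd₃, hd₂⟩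
    exact (L.cancel_right_of_respectsIso l' r).2 hl'
  exists_factorization := fac

end Orthogonality

namespace Gph

/-! ### Componentwise lemmas and invariance of the classes under isomorphism -/

@[ext]
theorem hom_ext {X Y : Gph.{u}} {f g : X ⟶ Y} (h₀ : ∀ x, f.onNode x = g.onNode x)
    (h₁ : ∀ a, f.onArc a = g.onArc a) : f = g :=
  Hom.ext (funext h₀) (funext h₁)

@[simp] theorem id_onNode (X : Gph.{u}) (x : X.Node) : Hom.onNode (𝟙 X) x = x := rfl
@[simp] theorem id_onArc (X : Gph.{u}) (a : X.Arc) : Hom.onArc (𝟙 X) a = a := rfl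
@[simp] theorem comp_onNode {X Y Z : Gph.{u}} (f : X ⟶ Y) (g : Y ⟶ Z) (x : X.Node) :
    Hom.onNode (f ≫ g) x = g.onNode (f.onNode x) := rfl
@[simp] theorem comp_onArc {X Y Z : Gph.{u}} (f : X ⟶ Y) (g : Y ⟶ Z) (a : X.Arc) :
    Hom.onArc (f ≫ g) a = g.onArc (f.onArc a) := rfl

theorem onNode_congr {X Y : Gph.{u}} {f g : X ⟶ Y} (h : f = g) (x : X.Node) :
    f.onNode x = g.onNode x := by rw [h]

theorem onArc_congr {X Y : Gph.{u}} {f g : X ⟶ Y} (h : f = g) (a : X.Arc) :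
    f.onArc a = g.onArc a := by rw [h]

/-- Any morphism maps out-arcs to out-arcs, so only uniqueness and existence of lifts of arcs
remain. -/
theorem covering_iff {X Y : Gph.{u}} (f : X ⟶ Y) : covering f ↔
    (∀ a b : X.Arc, X.src a = X.src b → f.onArc a = f.onArc b → a = b) ∧
      ∀ (x : X.Node) (b : Y.Arc), Y.src b = f.onNode x → ∃ a, X.src a = x ∧ f.onArc a = b := by
  refine ⟨fun h => ⟨fun a b hab e => (h (X.src b)).injOn hab rfl e,
    fun x b hb => (h x).surjOn hb⟩, fun h x => ⟨?_, ?_, h.2 x⟩⟩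
  · rintro a rfl
    exact f.src_onArc a
  · rintro a rfl b hb e
    exact h.1 a b hb.symm e

instance : covering.{u}.RespectsIso := by
  refine MorphismProperty.RespectsIso.mk _ ?_ ?_
  · intro X Y Z e f hf
    rw [covering_iff] at hf ⊢
    have hA (a : X.Arc) : e.inv.onArc (e.hom.onArc a) = a := onArc_congr e.hom_inv_id a
    have hN (a : X.Node) : e.inv.onNode (e.hom.onNode a) = a := onNode_congr e.hom_inv_id a
    have hA' (a : Y.Arc) : e.hom.onArc (e.inv.onArc a) = a := onArc_congr e.inv_hom_id a
    refine ⟨fun a b hs hab => ?_, fun x b hb => ?_⟩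
    · have := hf.1 (e.hom.onArc a) (e.hom.onArc b)
        (by rw [e.hom.src_onArc, e.hom.src_onArc, hs]) hab
      rw [← hA a, this, hA]
    · obtain ⟨a, ha, rfl⟩ := hf.2 _ b hb
      exact ⟨e.inv.onArc a, by rw [e.inv.src_onArc, ha, hN], by rw [comp_onArc, hA']⟩
  · intro X Y Z e f hf
    rw [covering_iff] at hf ⊢
    have hA (a : Y.Arc) : e.inv.onArc (e.hom.onArc a) = a := onArc_congr e.hom_inv_id a
    have hN (a : Y.Node) : e.inv.onNode (e.hom.onNode a) = a := onNode_congr e.hom_inv_id a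
    have hA' (a : Z.Arc) : e.hom.onArc (e.inv.onArc a) = a := onArc_congr e.inv_hom_id a
    refine ⟨fun a b hs hab => hf.1 a b hs ?_, fun x b hb => ?_⟩
    · rw [← hA (f.onArc a), ← hA (f.onArc b)]
      exact congrArg _ hab
    · obtain ⟨a, ha, hb'⟩ := hf.2 x (e.inv.onArc b) (by rw [e.inv.src_onArc, hb, comp_onNode, hN])
      exact ⟨a, ha, by rw [comp_onArc, hb', hA']⟩

instance : folding.{u}.RespectsIso := by
  refine MorphismProperty.RespectsIso.of_respects_arrow_iso _ fun f g e hf => ?_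
  obtain ⟨J, _, _, _, _, ⟨h⟩⟩ := (MorphismProperty.transfiniteCompositions_iff _ _).1 hf
  exact (MorphismProperty.transfiniteCompositions_iff _ _).2 ⟨J, _, _, _, _, ⟨h.ofArrowIso e⟩⟩

instance : whiskering.{u}.RespectsIso := by
  refine MorphismProperty.RespectsIso.mk _ ?_ ?_
  · rintro X Y Z e f ⟨F, φ, k, hF, h⟩
    exact ⟨F, φ ≫ e.inv, k, hF, h.of_iso (Iso.refl _) e.symm (Iso.refl _) (Iso.refl _)
      (by simp) (by simp) (by simp) (by simp)⟩
  · rintro X Y Z e f ⟨F, φ, k, hF, h⟩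
    exact ⟨F, φ, k ≫ e.hom, hF, h.of_iso (Iso.refl _) (Iso.refl _) (Iso.refl _) e
      (by simp) (by simp) (by simp) (by simp)⟩

instance : whiskerFold.{u}.RespectsIso := by
  refine MorphismProperty.RespectsIso.mk _ ?_ ?_
  · rintro X Y Z e f ⟨W, p, q, hp, hq, rfl⟩
    exact ⟨W, e.hom ≫ p, q, (whiskering.cancel_left_of_respectsIso _ _).2 hp, hq, by simp⟩
  · rintro X Y Z e f ⟨W, p, q, hp, hq, rfl⟩
    exact ⟨W, p, q ≫ e.hom, hp, (folding.cancel_right_of_respectsIso _ _).2 hq, by simp⟩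

/-! ### Foldings are orthogonal to coverings -/

instance epi_vFold : Epi vFold.{u} where
  left_cancellation f g h := by
    ext x
    · cases x
      · exact onNode_congr h .center
      · exact onNode_congr h .left
    · exact onArc_congr h .left

/-- The images in `A` of the two arcs of `V` have the same source and the same image in `B`, so
injectivity on out-arcs makes them equal; their targets then agree as well. -/
theorem covering.hasLiftingProperty_vFold {A B : Gph.{u}} {r : A ⟶ B} (hr : covering r) :
    HasLiftingProperty vFold.{u} r where
  sq_hasLift {f g} sq := by
    have hf : f.onArc .left = f.onArc .right := by
      refine ((covering_iff r).1 hr).1 _ _ ?_ ?_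
      · exact (f.src_onArc .left).trans (f.src_onArc .right).symm
      · exact (onArc_congr sq.w .left).trans (onArc_congr sq.w .right).symm
    have ht : f.onNode .left = f.onNode .right := 
      (f.tgt_onArc .left).symm.trans ((congrArg A.tgt hf).trans (f.tgt_onArc .right))
    refine ⟨⟨⟨Hom.mk (fun | .source => f.onNode .center | .target => f.onNode .left)
      (fun _ => f.onArc .left) (fun _ => f.src_onArc .left) (fun _ => f.tgt_onArc .left), ?_, ?_⟩⟩⟩
    · ext x
      · cases x
        · rfl
        · rfl
        · exact ht
      · cases x
        · rfl
        · exact hf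
    · ext x
      · cases x
        · exact onNode_congr sq.w .center
        · exact onNode_congr sq.w .left
      · exact onArc_congr sq.w .left

theorem folding_le_epimorphisms : folding.{u} ≤ MorphismProperty.epimorphisms Gph.{u} := by
  refine MorphismProperty.transfiniteCompositions_le_iff.2 ?_
  rintro X Y f ⟨h, k, sq⟩
  exact (MorphismProperty.epimorphisms Gph.{u}).of_isPushout sq epi_vFold

theorem folding_le_llp_covering : folding.{u} ≤ covering.{u}.llp := by
  refine MorphismProperty.transfiniteCompositions_le_iff.2 ?_
  rintro X Y f ⟨h, k, sq⟩
  exact covering.llp.of_isPushout sq fun _ _ _ hr => covering.hasLiftingProperty_vFold hr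

theorem folding.orthogonal {X Y A B : Gph.{u}} {l : X ⟶ Y} {r : A ⟶ B} (hl : folding l)
    (hr : covering r) : Orthogonal l r := by
  have : Epi l := folding_le_epimorphisms _ hl
  have : HasLiftingProperty l r := folding_le_llp_covering _ hl _ hr
  exact .of_hasLiftingProperty_of_epi l r

/-! ### Congruences, quotients and foldings -/

/-- A congruence on a graph: equivalence relations on nodes and on arcs compatible with sources
and targets. -/
@[ext]
structure Cong (X : Gph.{u}) where
  /-- The relation on nodes. -/
  node : Setoid X.Node
  /-- The relation on arcs. -/
  arc : Setoid X.Arc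
  src_rel : ∀ {a b}, arc a b → node (X.src a) (X.src b)
  tgt_rel : ∀ {a b}, arc a b → node (X.tgt a) (X.tgt b)

namespace Cong

variable {X : Gph.{u}}

instance : PartialOrder X.Cong :=
  PartialOrder.lift (fun E => (E.node, E.arc)) fun _ _ h =>
    Cong.ext (congrArg Prod.fst h) (congrArg Prod.snd h)

instance : InfSet X.Cong where
  sInf S :=
    { node := sInf (Cong.node '' S)
      arc := sInf (Cong.arc '' S)
      src_rel := by
        rintro a b h _ ⟨E, hE, rfl⟩
        exact E.src_rel (h _ ⟨E, hE, rfl⟩)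
      tgt_rel := by
        rintro a b h _ ⟨E, hE, rfl⟩
        exact E.tgt_rel (h _ ⟨E, hE, rfl⟩) }

instance : CompleteLattice X.Cong :=
  completeLatticeOfInf _ fun S => by
    refine ⟨fun E hE => ⟨fun x y h => h _ ⟨E, hE, rfl⟩, fun x y h => h _ ⟨E, hE, rfl⟩⟩,
      fun E hE => ?_⟩
    constructor
    · rintro x y h _ ⟨E', hE', rfl⟩
      exact (hE hE').1 h
    · rintro x y h _ ⟨E', hE', rfl⟩
      exact (hE hE').2 h

/-- The congruence generated by a set of pairs of nodes and a set of pairs of arcs. -/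
def gen (r : X.Node → X.Node → Prop) (s : X.Arc → X.Arc → Prop) : X.Cong :=
  sInf {E | (∀ x y, r x y → E.node x y) ∧ ∀ a b, s a b → E.arc a b}

theorem gen_le_iff {r : X.Node → X.Node → Prop} {s : X.Arc → X.Arc → Prop} {E : X.Cong} :
    gen r s ≤ E ↔ (∀ x y, r x y → E.node x y) ∧ ∀ a b, s a b → E.arc a b := by
  refine ⟨fun h => ⟨fun x y hxy => h.1 ?_, fun a b hab => h.2 ?_⟩, fun h => sInf_le h⟩
  · rintro _ ⟨E', hE', rfl⟩
    exact hE'.1 x y hxy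
  · rintro _ ⟨E', hE', rfl⟩
    exact hE'.2 a b hab

/-- The kernel of a morphism. -/
def ker {Y : Gph.{u}} (f : X ⟶ Y) : X.Cong where
  node := Setoid.ker f.onNode
  arc := Setoid.ker f.onArc
  src_rel {a b} h := by
    rw [Setoid.ker_def] at h ⊢
    rw [← f.src_onArc, h, f.src_onArc]
  tgt_rel {a b} h := by
    rw [Setoid.ker_def] at h ⊢
    rw [← f.tgt_onArc, h, f.tgt_onArc]

theorem ker_le_ker_comp {Y Z : Gph.{u}} (f : X ⟶ Y) (g : Y ⟶ Z) : ker f ≤ ker (f ≫ g) :=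
  ⟨fun _ _ h => congrArg g.onNode h, fun _ _ h => congrArg g.onArc h⟩

/-- The quotient of a graph by a congruence. -/
def quot (E : X.Cong) : Gph.{u} where
  Node := Quotient E.node
  Arc := Quotient E.arc
  src := Quotient.map' X.src fun _ _ => E.src_rel
  tgt := Quotient.map' X.tgt fun _ _ => E.tgt_rel

/-- The projection to the quotient. -/
def proj (E : X.Cong) : X ⟶ E.quot :=
  Hom.mk (Quotient.mk _) (Quotient.mk _) (fun _ => rfl) (fun _ => rfl)

theorem proj_onNode_surjective (E : X.Cong) : Function.Surjective E.proj.onNode :=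
  Quotient.mk_surjective

theorem proj_onArc_surjective (E : X.Cong) : Function.Surjective E.proj.onArc :=
  Quotient.mk_surjective

instance (E : X.Cong) : Epi E.proj where
  left_cancellation f g h := by
    ext x
    · obtain ⟨x, rfl⟩ := E.proj_onNode_surjective x
      exact onNode_congr h x
    · obtain ⟨x, rfl⟩ := E.proj_onArc_surjective x
      exact onArc_congr h x

@[simp]
theorem ker_proj (E : X.Cong) : ker E.proj = E := by
  refine Cong.ext (Setoid.ext fun x y => ?_) (Setoid.ext fun x y => ?_)
  · exact Quotient.eq
  · exact Quotient.eq

/-- The universal property of the quotient. -/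
def lift (E : X.Cong) {Y : Gph.{u}} (f : X ⟶ Y) (h : E ≤ ker f) : E.quot ⟶ Y :=
  Hom.mk (Quotient.lift f.onNode fun _ _ => @h.1 _ _) (Quotient.lift f.onArc fun _ _ => @h.2 _ _)
    (by rintro ⟨a⟩; exact f.src_onArc a) (by rintro ⟨a⟩; exact f.tgt_onArc a)

@[simp]
theorem proj_lift (E : X.Cong) {Y : Gph.{u}} (f : X ⟶ Y) (h : E ≤ ker f) :
    E.proj ≫ E.lift f h = f := rfl

theorem le_ker_of_proj_comp {E : X.Cong} {Y : Gph.{u}} {f : X ⟶ Y} {g : E.quot ⟶ Y}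
    (h : E.proj ≫ g = f) : E ≤ ker f := by
  rw [← h]
  conv_lhs => rw [← E.ker_proj]
  exact ker_le_ker_comp _ _

/-- The morphism between the quotients by two comparable congruences. -/
def quotMap {E E' : X.Cong} (h : E ≤ E') : E.quot ⟶ E'.quot :=
  E.lift E'.proj (by rwa [ker_proj])

/-- The functor taking a congruence to the quotient by it. -/
def quotFunctor (X : Gph.{u}) : X.Cong ⥤ Gph.{u} where
  obj := quot
  map f := quotMap (leOfHom f)
  map_id E := by rw [← cancel_epi E.proj]; rfl
  map_comp {E _ _} f g := by rw [← cancel_epi E.proj]; rfl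

/-- The quotient by a supremum of a chain of congruences is the colimit of the quotients. -/
noncomputable def isColimitQuotOfIsLUB {J : Type w} [Preorder J] [OrderBot J] (E : J ⥤ X.Cong)
    (S : X.Cong) (hS : IsLUB (Set.range E.obj) S)
    (ι : E ⋙ quotFunctor X ⟶ (Functor.const J).obj S.quot)
    (hι : ∀ j, (E.obj j).proj ≫ ι.app j = S.proj) : IsColimit (Cocone.mk S.quot ι) :=
  -- Precomposed with the projections from `X`, all legs become the leg at `⊥`. So each `E.obj j`,
  -- and therefore `S`, lies in the kernel of that one morphism. The family `f` is `s.ι.app` with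
  -- its type restated in terms of quotients.
  have leg (s : Cocone (E ⋙ quotFunctor X)) : ∃ f : ∀ j, (E.obj j).quot ⟶ s.pt,
      (∀ j, f j = s.ι.app j) ∧ ∀ j, (E.obj j).proj ≫ f j = (E.obj ⊥).proj ≫ f ⊥ := by
    refine ⟨s.ι.app, fun _ => rfl, fun j => ?_⟩
    exact (congrArg ((E.obj ⊥).proj ≫ ·) (s.w (homOfLE (bot_le : ⊥ ≤ j))) :)
  have leg' (j : J) {Z : Gph.{u}} (g : S.quot ⟶ Z) :
      (E.obj j).proj ≫ (ι.app j : (E.obj j).quot ⟶ S.quot) ≫ g = S.proj ≫ g :=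
    (congrArg (· ≫ g) (hι j) :)
  { desc := fun s => S.lift ((E.obj ⊥).proj ≫ (s.ι.app ⊥ : (E.obj ⊥).quot ⟶ s.pt)) (hS.2 (by
      rintro _ ⟨j, rfl⟩
      obtain ⟨f, hf, h⟩ := leg s
      rw [← hf]
      exact le_ker_of_proj_comp (h j)))
    fac := fun s j => by
      obtain ⟨f, hf, h⟩ := leg s
      refine (cancel_epi (E.obj j).proj).1 ((leg' j _).trans ?_)
      exact (congrArg ((E.obj ⊥).proj ≫ ·) (hf ⊥).symm).trans
        ((h j).symm.trans (congrArg ((E.obj j).proj ≫ ·) (hf j)))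
    uniq := fun s m hm => (cancel_epi S.proj).1 <|
      (congrArg (· ≫ m) (hι ⊥)).symm.trans (congrArg ((E.obj ⊥).proj ≫ ·) (hm ⊥)) }

/-- The congruence obtained from `E` by identifying two arcs. -/
def identify (E : X.Cong) (a b : X.Arc) : X.Cong :=
  E ⊔ gen (fun _ _ => False) (fun a' b' => a' = a ∧ b' = b)

theorem le_identify (E : X.Cong) (a b : X.Arc) : E ≤ E.identify a b := le_sup_left

theorem identify_le_iff {E E' : X.Cong} {a b : X.Arc} :
    E.identify a b ≤ E' ↔ E ≤ E' ∧ E'.arc a b := by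
  rw [identify, sup_le_iff, gen_le_iff]
  refine and_congr_right fun _ => ⟨fun h => h.2 a b ⟨rfl, rfl⟩, fun h => ⟨fun _ _ h => h.elim, ?_⟩⟩
  rintro _ _ ⟨rfl, rfl⟩
  exact h

theorem identify_rel (E : X.Cong) (a b : X.Arc) : (E.identify a b).arc a b :=
  (identify_le_iff.1 le_rfl).2

/-- The two arcs span a copy of `V` in `E.quot`, since their sources already agree there. The
pushout of `vFold` along it and the quotient by `E.identify a b` both classify morphisms from
`E.quot` that equate the two arcs. -/
theorem elementaryFolding_quotMap (E : X.Cong) {a b : X.Arc} (h : E.node (X.src a) (X.src b)) :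
    elementaryFolding (quotMap (E.le_identify a b)) := by
  have hs : E.proj.onNode (X.src b) = E.proj.onNode (X.src a) := (Quotient.sound h).symm
  have hab : (E.identify a b).proj.onArc a = (E.identify a b).proj.onArc b :=
    Quotient.sound (E.identify_rel a b)
  let v : vGraph.{u} ⟶ E.quot := Hom.mk
    (fun | .center => E.proj.onNode (X.src a)
         | .left => E.proj.onNode (X.tgt a)
         | .right => E.proj.onNode (X.tgt b))
    (fun | .left => E.proj.onArc a | .right => E.proj.onArc b)
    (fun | .left => rfl | .right => hs)
    (fun | .left => rfl | .right => rfl)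
  let k : arcGraph.{u} ⟶ (E.identify a b).quot := Hom.mk
    (fun | .source => (E.identify a b).proj.onNode (X.src a)
         | .target => (E.identify a b).proj.onNode (X.tgt a))
    (fun _ => (E.identify a b).proj.onArc a) (fun _ => rfl) (fun _ => rfl)
  have w : v ≫ quotMap (E.le_identify a b) = vFold ≫ k := by
    ext x
    · cases x
      · rfl
      · rfl
      · exact (congrArg (E.identify a b).quot.tgt hab).symm
    · cases x
      · rfl
      · exact hab.symm
  have hker (s : PushoutCocone v vFold.{u}) : E.identify a b ≤ ker (E.proj ≫ s.inl) :=
    identify_le_iff.2 ⟨le_ker_of_proj_comp rfl,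
      (onArc_congr s.condition .left).trans (onArc_congr s.condition .right).symm⟩
  refine ⟨v, k, ⟨w⟩, ⟨PushoutCocone.IsColimit.mk _ (fun s => lift _ _ (hker s)) ?_ ?_ ?_⟩⟩
  · intro s
    rw [← cancel_epi E.proj]
    rfl
  · intro s
    ext x
    · cases x
      · exact onNode_congr s.condition .center
      · exact onNode_congr s.condition .left
    · exact onArc_congr s.condition .left
  · intro s m hm _
    rw [← cancel_epi (E.identify a b).proj, proj_lift, ← hm]
    rfl

theorem _root_.Gph.folding_id (X : Gph.{u}) : folding (𝟙 X) :=
  MorphismProperty.transfiniteCompositionsOfShape_le_transfiniteCompositions _ _ _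
    (MorphismProperty.TransfiniteCompositionOfShape.ofOrderIso (.id _ X)
      -- The one-element indexing order is moved to universe `u`.
      (orderIsoShrink.{u} (Fin 1)).symm).mem

instance isIso_proj_bot : IsIso (proj (⊥ : X.Cong)) :=
  ⟨lift ⊥ (𝟙 X) bot_le, proj_lift _ _ _, (cancel_epi (proj ⊥)).1 rfl⟩

/-- The quotient by a transfinite iteration of identifications of arcs with the same source is
a folding. -/
theorem folding_proj_transfiniteIterate {J : Type u} [LinearOrder J] [OrderBot J] [SuccOrder J]
    [WellFoundedLT J] (a b : X.Cong → X.Arc)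
    (h : ∀ E : X.Cong, E.node (X.src (a E)) (X.src (b E))) (j : J) :
    folding (proj (transfiniteIterate (fun E => E.identify (a E) (b E)) j ⊥)) := by
  let φ (E : X.Cong) : X.Cong := E.identify (a E) (b E)
  have mono : Monotone fun j : J => transfiniteIterate φ j ⊥ :=
    monotone_transfiniteIterate φ ⊥ fun E => E.le_identify _ _
  have hbot : transfiniteIterate φ (⊥ : J) ⊥ = ⊥ := transfiniteIterate_bot φ ⊥
  let S : X.Cong := ⨆ j : J, transfiniteIterate φ j ⊥
  -- The whole iteration over `J` is one transfinite composition; its truncation `T.iic j` at `j`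
  -- gives the claim, up to the isomorphism between `X` and its quotient by `⊥`.
  let T : elementaryFolding.TransfiniteCompositionOfShape J (proj S) :=
    { F := mono.functor ⋙ quotFunctor X
      isoBot := ⟨lift _ (𝟙 X) (hbot.trans_le bot_le), proj _, (cancel_epi (proj _)).1 rfl, rfl⟩
      isWellOrderContinuous := ⟨fun m hm => by
        let : OrderBot (Set.Iio m) :=
          { bot := ⟨⊥, Order.IsSuccLimit.bot_lt hm⟩
            bot_le j := bot_le }
        have hS : IsLUB (Set.range ((Set.principalSegIio m).monotone.functor ⋙ mono.functor).obj)
            (transfiniteIterate φ m ⊥) := by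
          rw [transfiniteIterate_limit φ ⊥ m hm]
          exact isLUB_iSup
        exact ⟨isColimitQuotOfIsLUB ((Set.principalSegIio m).monotone.functor ⋙ mono.functor) _ hS
          ((Set.principalSegIio m).cocone (mono.functor ⋙ quotFunctor X)).ι fun j => rfl⟩⟩
      incl := ⟨fun j => quotMap (le_iSup (fun j : J => transfiniteIterate φ j ⊥) j),
        fun i j f => (cancel_epi (proj _)).1 rfl⟩
      isColimit := isColimitQuotOfIsLUB mono.functor S isLUB_iSup _ fun j => rfl
      fac := rfl
      map_mem := fun j hj => by
        have e := transfiniteIterate_succ φ (⊥ : X.Cong) j hj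
        have key (E : X.Cong) (he : E = φ (transfiniteIterate φ j ⊥))
            (hE : transfiniteIterate φ j ⊥ ≤ E) : elementaryFolding (quotMap hE) := by
          subst he
          exact elementaryFolding_quotMap _ (h _)
        exact key _ e (mono (Order.le_succ j)) }
  have hT : folding (T.F.map (homOfLE bot_le : ⊥ ⟶ j)) :=
    (MorphismProperty.transfiniteCompositions_iff _ _).2 ⟨_, _, _, _, _, ⟨T.iic j⟩⟩
  have : IsIso T.isoBot.inv := Iso.isIso_inv T.isoBot
  exact (folding.cancel_left_of_respectsIso T.isoBot.inv _).2 hT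

/-- A morphism is injective on out-arcs if arcs with the same source and the same image are
equal. -/
def _root_.Gph.OutInjective {X Y : Gph.{u}} (f : X ⟶ Y) : Prop :=
  ∀ a b : X.Arc, X.src a = X.src b → f.onArc a = f.onArc b → a = b

/-- Every morphism is a folding followed by a morphism that is injective on out-arcs. -/
theorem exists_folding_outInjective {Y : Gph.{u}} (f : X ⟶ Y) :
    ∃ (E : X.Cong) (h : E ≤ ker f), folding E.proj ∧ OutInjective (E.lift f h) := by
  -- The selection of pairs below needs an arc as default value.
  cases isEmpty_or_nonempty X.Arc with
  | inl hX =>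
    refine ⟨⊥, bot_le, ?_, ?_⟩
    · rw [← Category.comp_id (proj ⊥)]
      exact (folding.cancel_left_of_respectsIso _ _).2 (folding_id _)
    · rintro ⟨a⟩
      exact isEmptyElim a
  | inr hX =>
    -- Selects a pair of arcs still to be folded, or a trivial pair if there is none. Thus the
    -- selected pair is already identified in `E` only when nothing remains to fold.
    have pick (E : X.Cong) : ∃ a b : X.Arc, E.node (X.src a) (X.src b) ∧ f.onArc a = f.onArc b ∧
        (E.arc a b → ∀ a b : X.Arc, E.node (X.src a) (X.src b) → f.onArc a = f.onArc b →
          E.arc a b) := by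
      by_cases! h : ∃ a b : X.Arc, E.node (X.src a) (X.src b) ∧ f.onArc a = f.onArc b ∧ ¬ E.arc a b
      · obtain ⟨a, b, h₁, h₂, h₃⟩ := h
        exact ⟨a, b, h₁, h₂, fun h => (h₃ h).elim⟩
      · exact ⟨hX.some, hX.some, E.node.refl _, rfl, fun _ => h⟩
    choose a b hs hf hE using pick
    let φ (E : X.Cong) : X.Cong := E.identify (a E) (b E)
    -- There are more stages than congruences, so the iteration must repeat a value.
    let J : Type u := (Order.succ (Cardinal.mk X.Cong)).ord.ToType
    have : Nonempty J := by
      rw [Ordinal.nonempty_toType_iff]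
      simp
    let : OrderBot J := WellFoundedLT.toOrderBot J
    have hJ : ¬ Function.Injective fun j : J => transfiniteIterate φ j ⊥ := by
      intro hJ
      have := Cardinal.mk_le_of_injective hJ
      simp [J] at this
    have mono : Monotone fun j : J => transfiniteIterate φ j ⊥ :=
      monotone_transfiniteIterate φ ⊥ fun E => E.le_identify _ _
    have hker (j : J) : transfiniteIterate φ j ⊥ ≤ ker f := by
      induction j using SuccOrder.limitRecOn with
      | isMin j hj =>
        obtain rfl := hj.eq_bot
        rw [transfiniteIterate_bot]
        exact bot_le
      | succ j hj ih =>
        rw [transfiniteIterate_succ _ _ _ hj]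
        exact identify_le_iff.2 ⟨ih, hf _⟩
      | isSuccLimit j hj ih =>
        rw [transfiniteIterate_limit _ _ _ hj]
        exact iSup_le fun i => ih i.1 i.2
    obtain ⟨j, i, hji, e⟩ : ∃ j i : J, j < i ∧
        transfiniteIterate φ j ⊥ = transfiniteIterate φ i ⊥ := by
      grind [Function.Injective]
    -- By monotonicity, a value repeated at `j < i` is also the value at the successor of `j`: the
    -- fold at stage `j` changed nothing.
    have hfix : (transfiniteIterate φ j ⊥).arc (a (transfiniteIterate φ j ⊥))
        (b (transfiniteIterate φ j ⊥)) := by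
      have hle := mono (Order.succ_le_of_lt hji)
      dsimp only at hle
      rw [transfiniteIterate_succ _ _ _ (not_isMax_of_lt hji), ← e] at hle
      exact (identify_le_iff.1 hle).2
    refine ⟨_, hker j, folding_proj_transfiniteIterate a b hs j, ?_⟩
    rintro ⟨a'⟩ ⟨b'⟩ hs' hf'
    exact Quotient.sound (hE _ hfix a' b' (Quotient.exact hs') hf')

end Cong
/-! ### Rooted forests -/

/-- Every node is the target of at most one arc, and there is a depth function on nodes that
grows by one along each arc. -/
structure IsForestlike (F : Gph.{u}) : Prop where
  tgt_injective : Function.Injective F.tgt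
  exists_depth : ∃ d : F.Node → ℕ, ∀ a, d (F.tgt a) = d (F.src a) + 1

/-- The path of length zero at a node. -/
def GPath.nil {X : Gph.{u}} (x : X.Node) : X.GPath where
  length := 0
  hom := Hom.mk (fun _ => x) (fun i => i.down.elim0) (fun i => i.down.elim0)
    (fun i => i.down.elim0)

/-- The extension of a path by an arc at its end. -/
def GPath.snoc {X : Gph.{u}} (p : X.GPath) (a : X.Arc) (h : X.src a = p.last) : X.GPath where
  length := p.length + 1
  hom := Hom.mk
    (fun i => Fin.snoc (α := fun _ => X.Node) (fun j => p.hom.onNode ⟨j⟩) (X.tgt a) i.down)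
    (fun i => Fin.snoc (α := fun _ => X.Arc) (fun j => p.hom.onArc ⟨j⟩) a i.down)
    (by
      rintro ⟨i⟩
      induction i using Fin.lastCases with
      | last =>
        refine (congrArg X.src (Fin.snoc_last (α := fun _ => X.Arc) _ _)).trans (h.trans ?_)
        exact (Fin.snoc_castSucc (α := fun _ => X.Node) (X.tgt a) (fun j => p.hom.onNode ⟨j⟩)
          (Fin.last _)).symm
      | cast i =>
        refine (congrArg X.src (Fin.snoc_castSucc (α := fun _ => X.Arc) _ _ i)).trans
          ((p.hom.src_onArc ⟨i⟩).trans ?_)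
        exact (Fin.snoc_castSucc (α := fun _ => X.Node) (X.tgt a) (fun j => p.hom.onNode ⟨j⟩)
          i.castSucc).symm)
    (by
      rintro ⟨i⟩
      induction i using Fin.lastCases with
      | last =>
        refine (congrArg X.tgt (Fin.snoc_last (α := fun _ => X.Arc) _ _)).trans ?_
        exact (Fin.snoc_last (α := fun _ => X.Node) _ _).symm
      | cast i =>
        refine (congrArg X.tgt (Fin.snoc_castSucc (α := fun _ => X.Arc) _ _ i)).trans
          ((p.hom.tgt_onArc ⟨i⟩).trans ?_)
        exact (Fin.snoc_castSucc (α := fun _ => X.Node) (X.tgt a) (fun j => p.hom.onNode ⟨j⟩)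
          i.succ).symm)

/-- The last arc of a path, if any. -/
def GPath.lastArc? {X : Gph.{u}} : X.GPath → Option X.Arc
  | ⟨0, _⟩ => none
  | ⟨n + 1, p⟩ => some (p.onArc ⟨Fin.last n⟩)

section snoc

variable {X : Gph.{u}} (p : X.GPath) (a : X.Arc) (h : X.src a = p.last)

theorem GPath.first_snoc : (p.snoc a h).first = p.first :=
  Fin.snoc_castSucc (α := fun _ => X.Node) (X.tgt a) (fun j => p.hom.onNode ⟨j⟩) 0

theorem GPath.last_snoc : (p.snoc a h).last = X.tgt a :=
  Fin.snoc_last (α := fun _ => X.Node) (X.tgt a) (fun j => p.hom.onNode ⟨j⟩)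

theorem GPath.lastArc?_snoc : (p.snoc a h).lastArc? = some a :=
  congrArg some (Fin.snoc_last (α := fun _ => X.Arc) a (fun j => p.hom.onArc ⟨j⟩))

end snoc

/-- By uniqueness, the path to the target of `a` is the path to its source extended by `a`. Its last
arc recovers `a`, and path length serves as depth. -/
theorem IsRootedTree.isForestlike {T : Gph.{u}} (hT : T.IsRootedTree) : T.IsForestlike := by
  obtain ⟨r, -, hp⟩ := hT
  choose p hp hp' using hp
  dsimp only at hp'
  have key (a : T.Arc) : (p (T.src a)).snoc a (hp _).2.symm = p (T.tgt a) :=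
    hp' _ _ ⟨(GPath.first_snoc _ _ _).trans (hp _).1, GPath.last_snoc _ _ _⟩
  refine ⟨fun a b h => ?_, fun x => (p x).length, fun a => ?_⟩
  · have := congrArg GPath.lastArc? ((key a).trans ((congrArg p h).trans (key b).symm))
    rw [GPath.lastArc?_snoc, GPath.lastArc?_snoc] at this
    exact Option.some_injective _ this
  · dsimp only
    rw [← key]
    rfl

theorem GPath.depth_last {T : Gph.{u}} {d : T.Node → ℕ}
    (hd : ∀ a, d (T.tgt a) = d (T.src a) + 1) (p : T.GPath) :
    d p.last = d p.first + p.length := by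
  have key (i : Fin (p.length + 1)) : d (p.hom.onNode ⟨i⟩) = d p.first + i := by
    induction i using Fin.induction with
    | zero => rfl
    | succ i ih =>
      have h₁ := p.hom.tgt_onArc ⟨i⟩
      have h₂ := p.hom.src_onArc ⟨i⟩
      have h₃ := hd (p.hom.onArc ⟨i⟩)
      rw [h₁, h₂] at h₃
      exact h₃.trans (congrArg (· + 1) ih)
  exact key (Fin.last _)

/-- With at most one arc into each node, a path can be retraced from its end. -/
theorem pathGraph_hom_ext {T : Gph.{u}} (hT : Function.Injective T.tgt) {n : ℕ}
    {p q : pathGraph.{u} n ⟶ T} (h : p.onNode ⟨Fin.last n⟩ = q.onNode ⟨Fin.last n⟩) : p = q := by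
  have harc (i : Fin n) (hi : p.onNode ⟨i.succ⟩ = q.onNode ⟨i.succ⟩) :
      p.onArc ⟨i⟩ = q.onArc ⟨i⟩ :=
    hT ((p.tgt_onArc ⟨i⟩).trans (hi.trans (q.tgt_onArc ⟨i⟩).symm))
  have key (i : Fin (n + 1)) : p.onNode ⟨i⟩ = q.onNode ⟨i⟩ := by
    induction i using Fin.reverseInduction with
    | last => exact h
    | cast i ih =>
      exact (p.src_onArc ⟨i⟩).symm.trans ((congrArg T.src (harc i ih)).trans (q.src_onArc ⟨i⟩))
  ext ⟨i⟩
  · exact key i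
  · exact harc i (key _)

/-- A path from the root is found by stepping back along incoming arcs, by induction on depth. Depth
fixes the length of such a path, and `pathGraph_hom_ext` then fixes the path. -/
theorem IsForestlike.isRootedTree {T : Gph.{u}} (hT : T.IsForestlike) {r : T.Node}
    (hr : ∀ x, T.IsRoot x ↔ x = r) : T.IsRootedTree := by
  obtain ⟨hinj, d, hd⟩ := hT
  have hex (n : ℕ) : ∀ x, d x = n → ∃ p : T.GPath, p.first = r ∧ p.last = x := by
    induction n with
    | zero =>
      intro x hx
      refine ⟨.nil x, (hr x).1 fun a ha => ?_, rfl⟩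
      have := hd a
      rw [ha] at this
      omega
    | succ n ih =>
      intro x hx
      -- The depth function is not normalized, so a root may have positive depth.
      by_cases h : T.IsRoot x
      · exact ⟨.nil x, (hr x).1 h, rfl⟩
      · simp only [IsRoot, ne_eq, not_forall, not_not] at h
        obtain ⟨a, rfl⟩ := h
        obtain ⟨p, hp, hp'⟩ := ih (T.src a) (by have := hd a; omega)
        exact ⟨p.snoc a hp'.symm, (p.first_snoc _ _).trans hp, p.last_snoc _ _⟩
  refine ⟨r, hr, fun x => ?_⟩
  obtain ⟨p, hp, hp'⟩ := hex _ x rfl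
  refine ⟨p, ⟨hp, hp'⟩, ?_⟩
  rintro q ⟨hq, hq'⟩
  have hlen : q.length = p.length := by
    have h₁ := GPath.depth_last hd p
    have h₂ := GPath.depth_last hd q
    rw [hp, hp'] at h₁
    rw [hq, hq'] at h₂
    omega
  obtain ⟨m, p⟩ := p
  obtain ⟨n, q⟩ := q
  obtain rfl : n = m := hlen
  exact congrArg (GPath.mk n) (pathGraph_hom_ext hinj (hq'.trans hp'.symm))

/-- The disjoint union of a family of graphs. -/
def sigma {ι : Type u} (T : ι → Gph.{u}) : Gph.{u} where
  Node := Σ i, (T i).Node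
  Arc := Σ i, (T i).Arc
  src a := ⟨a.1, (T a.1).src a.2⟩
  tgt a := ⟨a.1, (T a.1).tgt a.2⟩

/-- The inclusion of a summand in the disjoint union. -/
def sigmaι {ι : Type u} (T : ι → Gph.{u}) (i : ι) : T i ⟶ sigma T :=
  Hom.mk (fun x => ⟨i, x⟩) (fun a => ⟨i, a⟩) (fun _ => rfl) (fun _ => rfl)

/-- The morphism from the disjoint union given by morphisms from the summands. -/
def sigmaDesc {ι : Type u} {T : ι → Gph.{u}} {Y : Gph.{u}} (f : ∀ i, T i ⟶ Y) : sigma T ⟶ Y :=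
  Hom.mk (fun x => (f x.1).onNode x.2) (fun a => (f a.1).onArc a.2)
    (fun a => (f a.1).src_onArc a.2) (fun a => (f a.1).tgt_onArc a.2)

/-- The disjoint union is a coproduct. -/
def isColimitSigma {ι : Type u} (T : ι → Gph.{u}) : IsColimit (Cofan.mk (sigma T) (sigmaι T)) :=
  Cofan.IsColimit.mk _ (fun s => sigmaDesc s.inj) (fun _ _ => rfl) fun s m hm => by
    ext ⟨i, x⟩
    · exact onNode_congr (hm i) x
    · exact onArc_congr (hm i) x

theorem IsForestlike.sigma {ι : Type u} {T : ι → Gph.{u}} (hT : ∀ i, (T i).IsForestlike) :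
    (sigma T).IsForestlike := by
  have hinj i := (hT i).tgt_injective
  choose d hd using fun i => (hT i).exists_depth
  refine ⟨?_, fun x => d x.1 x.2, fun a => hd a.1 a.2⟩
  rintro ⟨i, a⟩ ⟨j, b⟩ h
  obtain ⟨rfl, h⟩ := Sigma.mk.inj_iff.1 h
  exact congrArg (Sigma.mk i) (hinj i (eq_of_heq h))

theorem IsForestlike.of_injective {F G : Gph.{u}} (hG : G.IsForestlike) (f : F ⟶ G)
    (hf : Function.Injective f.onArc) : F.IsForestlike := by
  obtain ⟨hinj, d, hd⟩ := hG
  refine ⟨fun a b h => hf (hinj ?_), fun x => d (f.onNode x), fun a => ?_⟩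
  · rw [f.tgt_onArc, f.tgt_onArc, h]
  · dsimp only
    rw [← f.tgt_onArc, ← f.src_onArc, hd]

theorem IsRootedForest.isForestlike {F : Gph.{u}} (hF : F.IsRootedForest) : F.IsForestlike := by
  obtain ⟨ι, T, j, hT, ⟨hj⟩⟩ := hF
  let e : F ≅ sigma T := hj.coconePointUniqueUpToIso (isColimitSigma T)
  refine (IsForestlike.sigma fun i => (hT i).isForestlike).of_injective e.hom fun a b h => ?_
  rw [← id_onArc F a, ← id_onArc F b, ← e.hom_inv_id, comp_onArc, comp_onArc, h]

/-! ### Whiskerings are orthogonal to coverings -/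

/-- Recursion on depth: values at roots are prescribed by `f`, and any other node has a unique
incoming arc, which lifts uniquely from the lift of its source. -/
theorem IsForestlike.orthogonal {F A B : Gph.{u}} (hF : F.IsForestlike) {r : A ⟶ B}
    (hr : covering r) : Orthogonal F.rootsInclusion r := by
  intro f g e
  obtain ⟨hinj, d, hd⟩ := hF
  rw [covering_iff] at hr
  have hp (x : F.Node) (hx : ¬ F.IsRoot x) : ∃ a, F.tgt a = x := by
    simpa only [IsRoot, ne_eq, not_forall, not_not] using hx
  choose p hp using hp
  have hlift (a : F.Arc) (y : {y : A.Node // r.onNode y = g.onNode (F.src a)}) :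
      ∃ b : A.Arc, A.src b = y.1 ∧ r.onArc b = g.onArc a :=
    hr.2 y.1 (g.onArc a) (by rw [g.src_onArc, y.2])
  choose lift hlift₁ hlift₂ using hlift
  have hlift₃ (a : F.Arc) (y) : r.onNode (A.tgt (lift a y)) = g.onNode (F.tgt a) := by
    rw [← r.tgt_onArc, hlift₂, g.tgt_onArc]
  -- The recursion carries the proof that `N x` lies over `g.onNode x`, without which the next arc
  -- could not be lifted.
  have hN : ∃ N : ∀ x, {y : A.Node // r.onNode y = g.onNode x},
      (∀ x (hx : F.IsRoot x), (N x).1 = f.onNode ⟨x, hx⟩) ∧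
      ∀ x (hx : ¬ F.IsRoot x), (N x).1 = A.tgt (lift (p x hx) (N (F.src (p x hx)))) := by
    classical
    let N : ∀ x, {y : A.Node // r.onNode y = g.onNode x} := (measure d).wf.fix fun x ih =>
      if hx : F.IsRoot x then ⟨f.onNode ⟨x, hx⟩, onNode_congr e ⟨x, hx⟩⟩
      else ⟨A.tgt (lift (p x hx) (ih (F.src (p x hx)) (by
        change d _ < d _
        conv_rhs => rw [← hp x hx, hd]
        exact Nat.lt_succ_self _))), by rw [hlift₃, hp]⟩
    refine ⟨N, fun x hx => ?_, fun x hx => ?_⟩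
    · simp only [N]
      rw [WellFounded.fix_eq, dif_pos hx]
    · conv_lhs => simp only [N]
      rw [WellFounded.fix_eq, dif_neg hx]
  obtain ⟨N, hN₁, hN₂⟩ := hN
  have hN₃ (a : F.Arc) : (N (F.tgt a)).1 = A.tgt (lift a (N (F.src a))) := by
    have ha : ¬ F.IsRoot (F.tgt a) := fun h => h a rfl
    have := hN₂ _ ha
    -- The incoming arc chosen for the target of `a` is `a` itself.
    rwa [hinj (hp _ ha)] at this
  refine ⟨Hom.mk (fun x => (N x).1) (fun a => lift a (N (F.src a))) (fun a => hlift₁ _ _)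
    (fun a => (hN₃ a).symm), ⟨?_, ?_⟩, ?_⟩
  · ext x
    · exact hN₁ x.1 x.2
    · exact x.elim
  · ext x
    · exact (N x).2
    · exact hlift₂ _ _
  · rintro h ⟨h₁, h₂⟩
    have harc (a : F.Arc) (ha : h.onNode (F.src a) = (N (F.src a)).1) :
        h.onArc a = lift a (N (F.src a)) :=
      hr.1 _ _ (by rw [h.src_onArc, ha, hlift₁]) ((onArc_congr h₂ a).trans (hlift₂ _ _).symm)
    have hnode (x : F.Node) : h.onNode x = (N x).1 := by
      induction x using (measure d).wf.induction with
      | h x ih =>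
        by_cases hx : F.IsRoot x
        · exact (onNode_congr h₁ ⟨x, hx⟩).trans (hN₁ x hx).symm
        · obtain ⟨a, rfl⟩ : ∃ a, F.tgt a = x := ⟨_, hp x hx⟩
          have hlt : d (F.src a) < d (F.tgt a) := by rw [hd]; exact Nat.lt_succ_self _
          rw [← h.tgt_onArc, harc a (ih _ hlt), hN₃]
    ext x
    · exact hnode x
    · exact harc x (hnode _)

theorem whiskering.orthogonal {X Y A B : Gph.{u}} {l : X ⟶ Y} {r : A ⟶ B} (hl : whiskering l)
    (hr : covering r) : Orthogonal l r := by
  obtain ⟨F, φ, k, hF, sq⟩ := hl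
  exact (hF.isForestlike.orthogonal hr).of_isPushout sq

/-! ### The forest of walks -/

/-- The end of a list of arcs, latest arc first, as a walk from `y`. -/
def walkEnd {Y : Gph.{u}} (y : Y.Node) : List Y.Arc → Y.Node
  | [] => y
  | a :: _ => Y.tgt a

/-- A list of arcs, latest arc first, is a walk from `y`. -/
def IsWalk {Y : Gph.{u}} (y : Y.Node) : List Y.Arc → Prop
  | [] => True
  | a :: l => Y.src a = walkEnd y l ∧ IsWalk y l

/-- The tree of walks from a node. -/
def walkTree {Y : Gph.{u}} (y : Y.Node) : Gph.{u} where
  Node := {l : List Y.Arc // IsWalk y l}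
  Arc := {p : Y.Arc × List Y.Arc // IsWalk y (p.1 :: p.2)}
  src p := ⟨p.1.2, p.2.2⟩
  tgt p := ⟨p.1.1 :: p.1.2, p.2⟩

/-- The morphism taking a walk to its end. -/
def walkTreeEnd {Y : Gph.{u}} (y : Y.Node) : walkTree y ⟶ Y :=
  Hom.mk (fun l => walkEnd y l.1) (fun p => p.1.1) (fun p => p.2.1) (fun _ => rfl)

theorem isRoot_walkTree {Y : Gph.{u}} (y : Y.Node) (l : (walkTree y).Node) :
    (walkTree y).IsRoot l ↔ l = ⟨[], trivial⟩ := by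
  constructor
  · intro h
    obtain ⟨_ | ⟨a, l⟩, hl⟩ := l
    · rfl
    · exact (h ⟨(a, l), hl⟩ rfl).elim
  · rintro rfl a ha
    exact List.cons_ne_nil _ _ (congrArg Subtype.val ha)

/-- The target of an arc is a list whose head and tail recover the arc, and list length is a depth
function. -/
theorem isRootedTree_walkTree {Y : Gph.{u}} (y : Y.Node) : (walkTree y).IsRootedTree := by
  refine IsForestlike.isRootedTree ⟨?_, fun l => l.1.length, fun _ => rfl⟩ (isRoot_walkTree y)
  rintro ⟨⟨a, l⟩, _⟩ ⟨⟨b, l'⟩, _⟩ h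
  obtain ⟨rfl, rfl⟩ := List.cons.inj (congrArg Subtype.val h)
  rfl

theorem isRootedForest_sigma {ι : Type u} {T : ι → Gph.{u}} (hT : ∀ i, (T i).IsRootedTree) :
    (sigma T).IsRootedForest :=
  ⟨ι, T, sigmaι T, hT, ⟨isColimitSigma T⟩⟩

theorem isRoot_sigma_iff {ι : Type u} {T : ι → Gph.{u}} (i : ι) (x : (T i).Node) :
    (sigma T).IsRoot ⟨i, x⟩ ↔ (T i).IsRoot x := by
  refine ⟨fun h a ha => h ⟨i, a⟩ (by rw [← ha]; rfl), ?_⟩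
  rintro h ⟨j, a⟩ ha
  obtain ⟨rfl, ha⟩ := Sigma.mk.inj_iff.1 ha
  exact h a (eq_of_heq ha)

/-! ### Factorization -/

/-- Pushouts of graphs exist, and their nodes and arcs come from the two given graphs. -/
theorem exists_isPushout {R X F : Gph.{u}} (φ : R ⟶ X) (i : R ⟶ F) :
    ∃ (W : Gph.{u}) (p : X ⟶ W) (k : F ⟶ W), IsPushout φ i p k ∧
      ∀ w, (∃ x, p.onNode x = w) ∨ ∃ x, k.onNode x = w := by
  let S : Gph.{u} :=
    { Node := X.Node ⊕ F.Node
      Arc := X.Arc ⊕ F.Arc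
      src := Sum.map X.src F.src
      tgt := Sum.map X.tgt F.tgt }
  let inl : X ⟶ S := Hom.mk Sum.inl Sum.inl (fun _ => rfl) (fun _ => rfl)
  let inr : F ⟶ S := Hom.mk Sum.inr Sum.inr (fun _ => rfl) (fun _ => rfl)
  let E : S.Cong := .gen
    (fun s t => ∃ x, s = .inl (φ.onNode x) ∧ t = .inr (i.onNode x))
    (fun s t => ∃ x, s = .inl (φ.onArc x) ∧ t = .inr (i.onArc x))
  have hE := Cong.gen_le_iff.1 (le_refl E)
  let desc (s : PushoutCocone φ i) : S ⟶ s.pt :=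
    Hom.mk (Sum.elim s.inl.onNode s.inr.onNode) (Sum.elim s.inl.onArc s.inr.onArc)
      (by rintro (a | a); exacts [s.inl.src_onArc a, s.inr.src_onArc a])
      (by rintro (a | a); exacts [s.inl.tgt_onArc a, s.inr.tgt_onArc a])
  have hdesc (s : PushoutCocone φ i) : E ≤ Cong.ker (desc s) := by
    refine Cong.gen_le_iff.2 ⟨?_, ?_⟩
    · rintro _ _ ⟨x, rfl, rfl⟩
      exact onNode_congr s.condition x
    · rintro _ _ ⟨x, rfl, rfl⟩
      exact onArc_congr s.condition x
  have w : φ ≫ inl ≫ E.proj = i ≫ inr ≫ E.proj := by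
    ext x
    · exact Quotient.sound (hE.1 _ _ ⟨x, rfl, rfl⟩)
    · exact Quotient.sound (hE.2 _ _ ⟨x, rfl, rfl⟩)
  refine ⟨E.quot, inl ≫ E.proj, inr ≫ E.proj, ⟨⟨w⟩, ⟨PushoutCocone.IsColimit.mk _
    (fun s => E.lift (desc s) (hdesc s)) (fun _ => rfl) (fun _ => rfl) ?_⟩⟩, ?_⟩
  · intro s m hm₁ hm₂
    rw [← cancel_epi E.proj, Cong.proj_lift]
    ext x
    · obtain x | x := x
      · exact onNode_congr hm₁ x
      · exact onNode_congr hm₂ x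
    · obtain x | x := x
      · exact onArc_congr hm₁ x
      · exact onArc_congr hm₂ x
  · intro w
    obtain ⟨x | x, rfl⟩ := E.proj_onNode_surjective w
    · exact .inl ⟨x, rfl⟩
    · exact .inr ⟨x, rfl⟩

theorem exists_whiskerFold_covering {X Y : Gph.{u}} (c : X ⟶ Y) :
    ∃ (Z : Gph.{u}) (l : X ⟶ Z) (r : Z ⟶ Y), whiskerFold l ∧ covering r ∧ l ≫ r = c := by
  let T (x : X.Node) : Gph.{u} := walkTree (c.onNode x)
  let φ : (sigma T).roots ⟶ X :=
    Hom.mk (fun x => x.1.1) (fun a => a.elim) (fun a => a.elim) (fun a => a.elim)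
  let g : sigma T ⟶ Y := sigmaDesc fun x => walkTreeEnd (c.onNode x)
  have hroot (x : X.Node) : (sigma T).IsRoot ⟨x, ⟨[], trivial⟩⟩ :=
    (isRoot_sigma_iff x _).2 ((isRoot_walkTree _ _).2 rfl)
  have hg : φ ≫ c = (sigma T).rootsInclusion ≫ g := by
    ext x
    · obtain ⟨⟨x, l⟩, hx⟩ := x
      obtain rfl := (isRoot_walkTree _ l).1 ((isRoot_sigma_iff (T := T) x l).1 hx)
      rfl
    · exact x.elim
  obtain ⟨W, p, k, sq, hW⟩ := exists_isPushout φ (sigma T).rootsInclusion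
  -- Each node of `X` is glued to the empty walk of its tree, so lifts of arcs need to be found only
  -- at walks.
  have hk (w : W.Node) : ∃ x, k.onNode x = w := by
    obtain ⟨x, rfl⟩ | h := hW w
    · exact ⟨_, (onNode_congr sq.w ⟨_, hroot x⟩).symm⟩
    · exact h
  obtain ⟨E, hE, hfold, hinj⟩ := Cong.exists_folding_outInjective (sq.desc c g hg)
  refine ⟨E.quot, p ≫ E.proj, E.lift _ hE, ⟨W, p, E.proj,
    ⟨_, φ, k, isRootedForest_sigma fun x => isRootedTree_walkTree _, sq⟩, hfold, rfl⟩,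
    (covering_iff _).2 ⟨hinj, ?_⟩, ?_⟩
  · intro z b hb
    obtain ⟨w, rfl⟩ := E.proj_onNode_surjective z
    obtain ⟨⟨x, l⟩, rfl⟩ := hk w
    have hgk : k ≫ E.proj ≫ E.lift _ hE = g := by rw [Cong.proj_lift, sq.inr_desc]
    have hb' : Y.src b = walkEnd (c.onNode x) l.1 := hb.trans (onNode_congr hgk ⟨x, l⟩)
    -- The lift of `b` is the arc that extends the walk `l` by `b`.
    let a : (sigma T).Arc := ⟨x, ⟨(b, l.1), ⟨hb', l.2⟩⟩⟩
    refine ⟨E.proj.onArc (k.onArc a), ?_, onArc_congr hgk a⟩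
    rw [E.proj.src_onArc, k.src_onArc]
    rfl
  · rw [Category.assoc, Cong.proj_lift, sq.inl_desc]

end Gph

theorem proposition6 :
    IsFreydKellyFactorizationSystem (C := Gph.{u}) Gph.whiskerFold.{u} Gph.covering.{u} := by
  refine .of_orthogonal ?_ fun _ _ c => Gph.exists_whiskerFold_covering c
  rintro X Y A B _ r ⟨Z, p, q, hp, hq, rfl⟩ hr
  exact (hp.orthogonal hr).comp (hq.orthogonal hr)
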